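/- Let $A$ be a finite alphabet, and let $H_A$ be the set of finite unordered forests with nodes labelled by letters of $A$, a commutative monoid under disjoint union $+$ with identity the empty forest $0$. Let $V_A$ be the monoid of contexts (forests in which one leaf is replaced by a hole $\Box$, composed by substitution), acting on the right of $H_A$: for $s\in H_A$ and $p\in V_A$, $sp$ is the forest obtained by substituting $s$ for the hole of $p$. For a forest language $L\subseteq H_A$, write $s\sim_L t$ if $sp\in L\Leftrightarrow tp\in L$ for all $p\in V_A$, and for contexts write $p\sim_L q$ if $sp\sim_L sq$ for all $s\in H_A$. The syntactic forest algebra $(H_L,V_L)$ of $L$, which is the minimal forest algebra recognizing $L$, is the quotient of $(H_A,V_A)$ by these congruences; $H_L=H_A/{\sim_L}$ is its horizontal monoid. All nodes of a forest have the same $0$-definite type; for $k>0$ the $k$-definite type of a node is the pair $(a,T)$, where $a$ is the label of the node and $T$ is the set of $(k-1)$-definite types of its children. For $k>0$, write $s\equiv_k t$ if the set of $(k-1)$-definite types of the roots of $s$ equals that of the roots of $t$, and the set of $k$-definite types of all nodes of $s$ equals that of all nodes of $t$. The language $L$ is $k$-locally testable ($k>0$) if it is a union of $\equiv_k$-classes,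 and locally testable if it is $k$-locally testable for some $k>0$. Theorem. If $L\subseteq H_A$ is locally testable, then $H_L$ is finite and $L$ is $(|H_L|^2+1)$-locally testable. -/

import Mathlib

universe u v

namespace ForestLang

/-- Forest algebras with commutative horizontal monoid: `V` acts faithfully on the right of `H`,
and every insertion `g ↦ g v + h` is the action of an element of `V`. -/
structure ForestAlgebra where
  H : Type u
  V : Type u
  [instH : AddCommMonoid H]
  [instV : Monoid V]
  act : H → V → H
  act_mul : ∀ (h : H) (p q : V), act h (p * q) = act (act h p) q
  act_one : ∀ h : H, act h 1 = h
  faithful : ∀ p q : V, (∀ h : H, act h p = act h q) → p = q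
  exists_ins : ∀ (p : V) (h : H), ∃ q : V, ∀ g : H, act g q = act g p + h

attribute [instance] ForestAlgebra.instH ForestAlgebra.instV

/-- Homomorphisms of forest algebras. -/
structure ForestAlgebra.Hom (S : ForestAlgebra.{u}) (T : ForestAlgebra.{v}) where
  onH : S.H →+ T.H
  onV : S.V →* T.V
  map_act : ∀ (h : S.H) (p : S.V), onH (S.act h p) = T.act (onH h) (onV p)

/-- `S` divides `T`: `S` is a homomorphic image of a subalgebra `(K, W)` of `T`. As usual, `W` is
not required to act faithfully on `K`. -/
def ForestAlgebra.Divides (S : ForestAlgebra.{u}) (T : ForestAlgebra.{v}) : Prop :=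
  ∃ (K : AddSubmonoid T.H) (W : Submonoid T.V) (hact : ∀ h ∈ K, ∀ p ∈ W, T.act h p ∈ K)
    (φ : K →+ S.H) (ψ : W →* S.V),
    (∀ p ∈ W, ∀ h ∈ K, ∃ q ∈ W, ∀ g ∈ K, T.act g q = T.act g p + h) ∧
    Function.Surjective φ ∧ Function.Surjective ψ ∧
    ∀ (h : K) (p : W), φ ⟨T.act h p, hact h h.2 p p.2⟩ = S.act (φ h) (ψ p)

/-- Forest expressions over `A`: `0`, sums, and adjunction `s a` of a new root labelled `a`
above the forest `s`. -/
inductive Term (A : Type u) : Type u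
  | zero : Term A
  | add : Term A → Term A → Term A
  | node : Term A → A → Term A

/-- Two expressions denote the same (unordered) forest: the congruence generated by the laws of
commutative monoids. -/
inductive Term.Rel {A : Type u} : Term A → Term A → Prop
  | refl (s : Term A) : Rel s s
  | symm {s t : Term A} : Rel s t → Rel t s
  | trans {s t r : Term A} : Rel s t → Rel t r → Rel s r
  | add_congr {s s' t t' : Term A} : Rel s s' → Rel t t' → Rel (s.add t) (s'.add t')
  | node_congr {s s' : Term A} (a : A) : Rel s s' → Rel (s.node a) (s'.node a)
  | zero_add (s : Term A) : Rel (Term.zero.add s) s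
  | add_comm (s t : Term A) : Rel (s.add t) (t.add s)
  | add_assoc (s t r : Term A) : Rel ((s.add t).add r) (s.add (t.add r))

/-- Equality of unordered forests, as a setoid on expressions. -/
def Term.setoid (A : Type u) : Setoid (Term A) where
  r := Term.Rel
  iseqv := ⟨Term.Rel.refl, Term.Rel.symm, Term.Rel.trans⟩

/-- The set `H_A` of finite unordered forests with nodes labelled by `A`. -/
def Forest (A : Type u) : Type u := Quotient (Term.setoid A)

namespace Forest

variable {A : Type u}

instance : Zero (Forest A) := ⟨Quotient.mk _ Term.zero⟩

instance : Add (Forest A) :=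
  ⟨Quotient.map₂ Term.add (fun _ _ h _ _ h' => Term.Rel.add_congr h h')⟩

/-- The tree with root label `a` whose root has the trees of `s` as its children. -/
def node (s : Forest A) (a : A) : Forest A :=
  Quotient.map (fun t => Term.node t a) (fun _ _ h => Term.Rel.node_congr a h) s

instance : AddCommMonoid (Forest A) where
  zero_add s := by
    induction s using Quotient.ind with | _ s => exact Quotient.sound (Term.Rel.zero_add s)
  add_zero s := by
    induction s using Quotient.ind with
    | _ s => exact Quotient.sound ((Term.Rel.add_comm _ _).trans (Term.Rel.zero_add s))
  add_comm s t := by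
    induction s, t using Quotient.ind₂ with | _ s t => exact Quotient.sound (Term.Rel.add_comm s t)
  add_assoc s t r := by
    induction s, t using Quotient.ind₂ with
    | _ s t =>
      induction r using Quotient.ind with
      | _ r => exact Quotient.sound (Term.Rel.add_assoc s t r)
  nsmul := nsmulRec

end Forest

/-- The transformations `s ↦ s p` of `H_A` given by contexts `p`: a context is the hole alone,
a context with a forest put beside it, or a context with a new root put above it. -/
inductive IsContext {A : Type u} : (Forest A → Forest A) → Prop
  | hole : IsContext (fun s => s)
  | add {f : Forest A → Forest A} (t : Forest A) : IsContext f → IsContext (fun s => f s + t)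
  | node {f : Forest A → Forest A} (a : A) : IsContext f → IsContext (fun s => (f s).node a)

/-- The set `V_A` of contexts. A context is determined by the map that substitutes a forest for
its hole, and is identified with this map. -/
def Context (A : Type u) : Type u := {f : Forest A → Forest A // IsContext f}

theorem IsContext.comp {A : Type u} {f g : Forest A → Forest A} (hf : IsContext f)
    (hg : IsContext g) : IsContext (fun s => g (f s)) := by
  induction hg with
  | hole => exact hf
  | add t _ ih => exact ih.add t
  | node a _ ih => exact ih.node a

/-- The product `p * q` substitutes `p` for the hole of `q`. -/
instance (A : Type u) : Monoid (Context A) where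
  one := ⟨fun s => s, IsContext.hole⟩
  mul p q := ⟨fun s => q.1 (p.1 s), p.2.comp q.2⟩
  one_mul _ := rfl
  mul_one _ := rfl
  mul_assoc _ _ _ := rfl

/-- The free forest algebra `A^Δ = (H_A, V_A)`. -/
def freeForestAlgebra (A : Type u) : ForestAlgebra.{u} where
  H := Forest A
  V := Context A
  act s p := p.1 s
  act_mul _ _ _ := rfl
  act_one _ := rfl
  faithful _ _ h := Subtype.ext (funext h)
  exists_ins p h := ⟨⟨_, p.2.add h⟩, fun _ => rfl⟩

/-- `S` recognizes the forest language `L`. -/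
def ForestAlgebra.Recognizes {A : Type u} (S : ForestAlgebra.{v}) (L : Set (Forest A)) : Prop :=
  ∃ (α : (freeForestAlgebra A).Hom S) (X : Set S.H), L = {s : Forest A | α.onH s ∈ X}

/-- The context `□ + t`. -/
def Context.insHole {A : Type u} (t : Forest A) : Context A := ⟨_, IsContext.hole.add t⟩

section Syntactic

variable {A : Type u} (L : Set (Forest A))

/-- The horizontal syntactic congruence of `L`: no context distinguishes the two forests. -/
def synConH : AddCon (Forest A) where
  r s t := ∀ p : Context A, p.1 s ∈ L ↔ p.1 t ∈ L
  iseqv := ⟨fun _ _ => Iff.rfl, fun h p => (h p).symm, fun h h' p => (h p).trans (h' p)⟩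
  add' := by
    intro s s' t t' h h' p
    have h1 := h (Context.insHole t * p)
    have h2 := h' (Context.insHole s' * p)
    change p.1 (s + t) ∈ L ↔ p.1 (s' + t) ∈ L at h1
    change p.1 (t + s') ∈ L ↔ p.1 (t' + s') ∈ L at h2
    rw [add_comm t s', add_comm t' s'] at h2
    exact h1.trans h2

/-- The vertical syntactic congruence of `L`: the two contexts send every forest to syntactically
congruent forests. -/
def synConV : Con (Context A) where
  r p q := ∀ s : Forest A, synConH L (p.1 s) (q.1 s)
  iseqv := ⟨fun _ _ => (synConH L).refl _, fun h s => (synConH L).symm (h s),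
    fun h h' s => (synConH L).trans (h s) (h' s)⟩
  mul' := by
    intro p p' q q' h h' s
    exact (synConH L).trans (fun c => h s (q * c)) (h' (p'.1 s))

/-- The syntactic forest algebra `(H_L, V_L)` of `L`. -/
def syntacticForestAlgebra : ForestAlgebra.{u} where
  H := (synConH L).Quotient
  V := (synConV L).Quotient
  act h p := Quotient.liftOn₂ h p (fun s q => ((q.1 s : Forest A) : (synConH L).Quotient)) (by
    intro s q s' q' h h'
    exact (synConH L).eq.2 ((synConH L).trans (fun c => h (q * c)) (h' s')))
  act_mul h p q := by
    induction h using AddCon.induction_on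
    induction p using Con.induction_on
    induction q using Con.induction_on
    rfl
  act_one h := by
    induction h using AddCon.induction_on
    rfl
  faithful p q h := by
    induction p using Con.induction_on
    induction q using Con.induction_on
    exact (synConV L).eq.2 fun s => (synConH L).eq.1 (h (s : (synConH L).Quotient))
  exists_ins p h := by
    induction p using Con.induction_on with | _ p =>
    induction h using AddCon.induction_on with | _ t =>
    refine ⟨(synConV L).mk' ⟨_, p.2.add t⟩, fun g => ?_⟩
    induction g using AddCon.induction_on
    rfl

/-- The syntactic morphism of `L`. -/
def syntacticMorphism : (freeForestAlgebra A).Hom (syntacticForestAlgebra L) where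
  onH := (synConH L).mk'
  onV := (synConV L).mk'
  map_act _ _ := rfl

/-- The syntactic forest algebra recognizes `L`, through the syntactic morphism. -/
theorem syntacticForestAlgebra_recognizes : (syntacticForestAlgebra L).Recognizes L := by
  refine ⟨syntacticMorphism L, (synConH L).mk' '' L, Set.ext fun s => ⟨fun h => ⟨s, h, rfl⟩, ?_⟩⟩
  rintro ⟨t, ht, hts⟩
  exact ((synConH L).eq.1 hts 1).1 ht

/-- The syntactic forest algebra is minimal: it divides every forest algebra recognizing `L`. -/
theorem syntacticForestAlgebra_divides (T : ForestAlgebra.{v}) (hT : T.Recognizes L) :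
    (syntacticForestAlgebra L).Divides T := by
  obtain ⟨α, X, hX⟩ := hT
  have memL : ∀ s : Forest A, s ∈ L ↔ α.onH s ∈ X := fun s => by
    conv_lhs => rw [hX]
    rfl
  have key : ∀ s t : Forest A, α.onH s = α.onH t → synConH L s t := by
    intro s t h p
    rw [memL, memL]
    have h1 := α.map_act s p
    have h2 := α.map_act t p
    rw [h] at h1
    change α.onH (p.1 s) = _ at h1
    change α.onH (p.1 t) = _ at h2
    rw [h1, h2]
  have keyV : ∀ p q : Context A, α.onV p = α.onV q → synConV L p q := by
    intro p q h s
    apply key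
    have h1 := α.map_act s p
    have h2 := α.map_act s q
    rw [h] at h1
    exact h1.trans h2.symm
  let K : AddSubmonoid T.H := AddMonoidHom.mrange α.onH
  let W : Submonoid T.V := MonoidHom.mrange α.onV
  have hK : ∀ h : K, ∃ s : Forest A, α.onH s = h := fun h => h.2
  have hW : ∀ p : W, ∃ q : Context A, α.onV q = p := fun p => p.2
  choose f hf using hK
  choose g hg using hW
  let mkH : Forest A →+ (syntacticForestAlgebra L).H := (syntacticMorphism L).onH
  let mkV : Context A →* (syntacticForestAlgebra L).V := (syntacticMorphism L).onV
  have eqH : ∀ s t : Forest A, α.onH s = α.onH t → mkH s = mkH t :=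
    fun s t h => (synConH L).eq.2 (key s t h)
  have eqV : ∀ p q : Context A, α.onV p = α.onV q → mkV p = mkV q :=
    fun p q h => (synConV L).eq.2 (keyV p q h)
  have addH : ∀ s t : Forest A, α.onH (s + t) = α.onH s + α.onH t := α.onH.map_add
  have mulV : ∀ p q : Context A, α.onV (p * q) = α.onV p * α.onV q := α.onV.map_mul
  have hact : ∀ h ∈ K, ∀ p ∈ W, T.act h p ∈ K := by
    rintro _ ⟨s, rfl⟩ _ ⟨p, rfl⟩
    exact ⟨_, α.map_act s p⟩
  refine ⟨K, W, hact, ⟨⟨fun h => mkH (f h), ?_⟩, ?_⟩, ⟨⟨fun p => mkV (g p), ?_⟩, ?_⟩,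
    ?_, ?_, ?_, ?_⟩
  · rw [← map_zero mkH]
    apply eqH
    rw [hf]
    exact α.onH.map_zero.symm
  · intro x y
    change mkH _ = mkH _ + mkH _
    rw [← map_add mkH]
    apply eqH
    rw [addH, hf, hf, hf]
    rfl
  · rw [← map_one mkV]
    apply eqV
    rw [hg]
    exact α.onV.map_one.symm
  · intro x y
    change mkV _ = mkV _ * mkV _
    rw [← map_mul mkV]
    apply eqV
    rw [mulV, hg, hg, hg]
    rfl
  · rintro _ ⟨p, rfl⟩ _ ⟨t, rfl⟩
    let p' : Context A := p
    let q : Context A := ⟨_, p'.2.add t⟩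
    refine ⟨α.onV q, ⟨q, rfl⟩, ?_⟩
    rintro _ ⟨s, rfl⟩
    have h1 := α.map_act s q
    have h2 := α.map_act s p
    exact h1.symm.trans ((addH (p'.1 s) t).trans (congrArg (· + α.onH t) h2))
  · intro h
    obtain ⟨s, rfl⟩ := AddCon.mk'_surjective h
    exact ⟨⟨α.onH s, ⟨s, rfl⟩⟩, eqH _ _ (hf _)⟩
  · intro p
    obtain ⟨q, rfl⟩ := Con.mk'_surjective p
    exact ⟨⟨α.onV q, ⟨q, rfl⟩⟩, eqV _ _ (hg _)⟩
  · intro h p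
    have h1 := α.map_act (f h) (g p)
    rw [hf, hg] at h1
    exact eqH _ ((g p).1 (f h)) ((hf _).trans h1.symm)

end Syntactic

/-- `DefType A k` contains the `k`-definite types: there is only one `0`-definite type, and a
`(k+1)`-definite type is a label together with a set of `k`-definite types. -/
def DefType (A : Type u) : ℕ → Type u
  | 0 => PUnit
  | k + 1 => A × Set (DefType A k)

/-- The `k`-definite type of a node labelled `a`, when `T j` is the set of `j`-definite types of
its children. -/
def nodeType {A : Type u} (a : A) (T : (j : ℕ) → Set (DefType A j)) : (k : ℕ) → DefType A k
  | 0 => PUnit.unit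
  | j + 1 => (a, T j)

/-- The set of `k`-definite types of the roots of the forest denoted by an expression. -/
def Term.rootTypes {A : Type u} : Term A → (k : ℕ) → Set (DefType A k)
  | .zero, _ => ∅
  | .add s t, k => s.rootTypes k ∪ t.rootTypes k
  | .node s a, k => {nodeType a s.rootTypes k}

/-- The set of `k`-definite types of all nodes of the forest denoted by an expression. -/
def Term.nodeTypes {A : Type u} : Term A → (k : ℕ) → Set (DefType A k)
  | .zero, _ => ∅
  | .add s t, k => s.nodeTypes k ∪ t.nodeTypes k
  | .node s a, k => insert (nodeType a s.rootTypes k) (s.nodeTypes k)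

theorem Term.Rel.rootTypes_eq {A : Type u} {s t : Term A} (h : Term.Rel s t) :
    s.rootTypes = t.rootTypes := by
  induction h with
  | refl => rfl
  | symm _ ih => exact ih.symm
  | trans _ _ ih ih' => exact ih.trans ih'
  | add_congr _ _ ih ih' => funext k; simp only [Term.rootTypes, ih, ih']
  | node_congr a _ ih => funext k; simp only [Term.rootTypes, ih]
  | zero_add s => funext k; simp only [Term.rootTypes, Set.empty_union]
  | add_comm s t => funext k; simp only [Term.rootTypes, Set.union_comm]
  | add_assoc s t r => funext k; simp only [Term.rootTypes, Set.union_assoc]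

theorem Term.Rel.nodeTypes_eq {A : Type u} {s t : Term A} (h : Term.Rel s t) :
    s.nodeTypes = t.nodeTypes := by
  induction h with
  | refl => rfl
  | symm _ ih => exact ih.symm
  | trans _ _ ih ih' => exact ih.trans ih'
  | add_congr _ _ ih ih' => funext k; simp only [Term.nodeTypes, ih, ih']
  | node_congr a h ih => funext k; simp only [Term.nodeTypes, ih, h.rootTypes_eq]
  | zero_add s => funext k; simp only [Term.nodeTypes, Set.empty_union]
  | add_comm s t => funext k; simp only [Term.nodeTypes, Set.union_comm]
  | add_assoc s t r => funext k; simp only [Term.nodeTypes, Set.union_assoc]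

/-- The set of `k`-definite types of the roots of a forest. -/
def Forest.rootTypes {A : Type u} (k : ℕ) : Forest A → Set (DefType A k) :=
  Quotient.lift (fun s => s.rootTypes k) (fun _ _ h => congrFun (Term.Rel.rootTypes_eq h) k)

/-- The set of `k`-definite types of all nodes of a forest. -/
def Forest.nodeTypes {A : Type u} (k : ℕ) : Forest A → Set (DefType A k) :=
  Quotient.lift (fun s => s.nodeTypes k) (fun _ _ h => congrFun (Term.Rel.nodeTypes_eq h) k)

/-- `s ∼_k t`: the roots of `s` and of `t` have the same `k`-definite types. -/
def DefEquiv {A : Type u} (k : ℕ) (s t : Forest A) : Prop :=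
  s.rootTypes k = t.rootTypes k

/-- `s ≡_k t`, for `k > 0`: `s ∼_{k-1} t`, and the nodes of `s` and of `t` have the same
`k`-definite types. -/
def LTEquiv {A : Type u} (k : ℕ) (s t : Forest A) : Prop :=
  DefEquiv (k - 1) s t ∧ s.nodeTypes k = t.nodeTypes k

/-- `L` is `k`-locally testable: `k > 0` and `L` is a union of `≡_k`-classes. -/
def IsKLocallyTestable {A : Type u} (k : ℕ) (L : Set (Forest A)) : Prop :=
  0 < k ∧ ∀ s t : Forest A, LTEquiv k s t → s ∈ L → t ∈ L

/-- `L` is locally testable: it is `k`-locally testable for some `k`. -/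
def IsLocallyTestable {A : Type u} (L : Set (Forest A)) : Prop :=
  ∃ k : ℕ, IsKLocallyTestable k L

end ForestLang

/-! Let π map a forest to its value in `H_L`. If `L` is (k+1)-locally testable, then π is idempotent
and exchange holds at level k: π(f s) + π(g t) = π(f t) + π(g s) for all contexts f, g whenever s
∼_k t.

Exchange depends on s and t only through their values. Let P_m be the set of value pairs of
∼_m-equivalent forests. The P_m decrease inside a set with |H_L|² elements, and one equality P_m =
P_{m+1} forces equality ever after, so the chain is constant from index |H_L|² at the latest. Hence
exchange at any level descends to level |H_L|² (`swapInvariant_card_sq`).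

Conversely, exchange at level k and idempotence make π constant on ≡_{k+1}-classes
(`eq_of_ltEquiv`): if s ≡_{k+1} t, then t can be absorbed by s tree by tree, and symmetrically, so π
s = π(s + t) = π t. The work is in `exists_map_context_add_node` and `map_context_add_of_subset`. -/

namespace ForestLang

open Set

/-! ### Definite types of sums, trees and contexts -/

namespace Forest

variable {A : Type u}

theorem induct {P : Forest A → Prop} (zero : P 0) (add : ∀ s t, P s → P t → P (s + t))
    (node : ∀ s a, P s → P (s.node a)) (s : Forest A) : P s := by
  induction s using Quotient.ind with | _ s =>
  induction s with
  | zero => exact zero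
  | add s t hs ht => exact add _ _ hs ht
  | node s a hs => exact node _ a hs

theorem rootTypes_zero (k : ℕ) : (0 : Forest A).rootTypes k = ∅ := rfl

theorem rootTypes_add (k : ℕ) (s t : Forest A) :
    (s + t).rootTypes k = s.rootTypes k ∪ t.rootTypes k := by
  induction s, t using Quotient.ind₂ with | _ s t => rfl

theorem rootTypes_node (k : ℕ) (s : Forest A) (a : A) :
    (s.node a).rootTypes k = {nodeType a (fun j => s.rootTypes j) k} := by
  induction s using Quotient.ind with | _ s => rfl

theorem nodeTypes_add (k : ℕ) (s t : Forest A) :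
    (s + t).nodeTypes k = s.nodeTypes k ∪ t.nodeTypes k := by
  induction s, t using Quotient.ind₂ with | _ s t => rfl

theorem nodeTypes_node (k : ℕ) (s : Forest A) (a : A) :
    (s.node a).nodeTypes k = insert (nodeType a (fun j => s.rootTypes j) k) (s.nodeTypes k) := by
  induction s using Quotient.ind with | _ s => rfl

end Forest

/-- The `k`-definite type determined by a `(k+1)`-definite type. -/
def DefType.trunc {A : Type u} : (k : ℕ) → DefType A (k + 1) → DefType A k
  | 0, _ => PUnit.unit
  | k + 1, x => (x.1, DefType.trunc k '' x.2)

namespace Forest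

variable {A : Type u}

theorem image_trunc_rootTypes (k : ℕ) (s : Forest A) :
    DefType.trunc k '' s.rootTypes (k + 1) = s.rootTypes k := by
  induction k generalizing s with
  | zero =>
    induction s using induct with
    | zero => simp only [rootTypes_zero, image_empty]
    | add s t hs ht => simp only [rootTypes_add, image_union, hs, ht]
    | node s a _ => rw [rootTypes_node, rootTypes_node, image_singleton]; rfl
  | succ k ih =>
    induction s using induct with
    | zero => simp only [rootTypes_zero, image_empty]
    | add s t hs ht => simp only [rootTypes_add, image_union, hs, ht]
    | node s a _ =>
      rw [rootTypes_node, rootTypes_node, image_singleton]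
      exact congrArg (fun T => {((a, T) : A × Set (DefType A k))}) (ih s)

theorem trunc_nodeType (k : ℕ) (s : Forest A) (a : A) :
    DefType.trunc k (nodeType a (fun j => s.rootTypes j) (k + 1)) =
      nodeType a (fun j => s.rootTypes j) k := by
  have h := image_trunc_rootTypes k (s.node a)
  rwa [rootTypes_node, rootTypes_node, image_singleton, singleton_eq_singleton_iff] at h

end Forest

namespace DefEquiv

variable {A : Type u} {k : ℕ} {s t s' t' : Forest A}

theorem of_succ (h : DefEquiv (k + 1) s t) : DefEquiv k s t := by
  unfold DefEquiv at *
  rw [← Forest.image_trunc_rootTypes, h, Forest.image_trunc_rootTypes]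

theorem mono {m : ℕ} (hm : m ≤ k) (h : DefEquiv k s t) : DefEquiv m s t := by
  induction hm with
  | refl => exact h
  | step _ ih => exact ih h.of_succ

theorem add (h : DefEquiv k s t) (h' : DefEquiv k s' t') : DefEquiv k (s + s') (t + t') := by
  unfold DefEquiv at *
  rw [Forest.rootTypes_add, Forest.rootTypes_add, h, h']

theorem node_succ (h : DefEquiv k s t) (a : A) : DefEquiv (k + 1) (s.node a) (t.node a) := by
  unfold DefEquiv at *
  rw [Forest.rootTypes_node, Forest.rootTypes_node]
  exact congrArg (fun T => {((a, T) : A × Set (DefType A k))}) h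

theorem context {f : Forest A → Forest A} (hf : IsContext f) (h : DefEquiv k s t) :
    DefEquiv k (f s) (f t) := by
  induction hf with
  | hole => exact h
  | add r _ ih => exact ih.add rfl
  | node a _ ih => exact (ih.node_succ a).of_succ

end DefEquiv

namespace Forest

variable {A : Type u}

theorem exists_eq_node_add {k : ℕ} {s : Forest A} {x : DefType A k} (hx : x ∈ s.rootTypes k) :
    ∃ (v : Forest A) (a : A) (r : Forest A), s = v.node a + r ∧ x = nodeType a (fun j => v.rootTypes j) k := by
  induction s using induct with
  | zero => exact hx.elim
  | add s t hs ht =>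
    rw [rootTypes_add] at hx
    rcases hx with hx | hx
    · obtain ⟨v, a, r, rfl, h⟩ := hs hx
      exact ⟨v, a, r + t, add_assoc _ _ _, h⟩
    · obtain ⟨v, a, r, rfl, h⟩ := ht hx
      exact ⟨v, a, s + r, add_left_comm _ _ _, h⟩
  | node s a _ =>
    rw [rootTypes_node] at hx
    exact ⟨s, a, 0, (add_zero _).symm, hx⟩

theorem exists_eq_context_node {k : ℕ} {s : Forest A} {x : DefType A k}
    (hx : x ∈ s.nodeTypes k) :
    ∃ (v : Forest A) (a : A) (f : Forest A → Forest A), IsContext f ∧ s = f (v.node a) ∧ x = nodeType a (fun j => v.rootTypes j) k := by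
  induction s using induct with
  | zero => exact hx.elim
  | add s t hs ht =>
    rw [nodeTypes_add] at hx
    rcases hx with hx | hx
    · obtain ⟨v, a, f, hf, rfl, h⟩ := hs hx
      exact ⟨v, a, _, hf.add t, rfl, h⟩
    · obtain ⟨v, a, f, hf, rfl, h⟩ := ht hx
      exact ⟨v, a, _, hf.add s, add_comm _ _, h⟩
  | node s b hs =>
    rw [nodeTypes_node] at hx
    rcases hx with hx | hx
    · exact ⟨s, b, _, IsContext.hole, rfl, hx⟩
    · obtain ⟨v, a, f, hf, rfl, h⟩ := hs hx
      exact ⟨v, a, _, hf.node b, rfl, h⟩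

/-- The nodes of a context contribute a set of `(k+1)`-definite types that depends only on the
`k`-definite types of the roots of the forest substituted for the hole. -/
theorem exists_nodeTypes_context {f : Forest A → Forest A} (hf : IsContext f) (k : ℕ)
    (u : Forest A) :
    ∃ N, ∀ s, DefEquiv k s u → (f s).nodeTypes (k + 1) = s.nodeTypes (k + 1) ∪ N := by
  induction hf with
  | hole => exact ⟨∅, fun s _ => (union_empty _).symm⟩
  | add t _ ih =>
    obtain ⟨N, hN⟩ := ih
    exact ⟨N ∪ t.nodeTypes (k + 1), fun s hs => by rw [nodeTypes_add, hN s hs, union_assoc]⟩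
  | @node f a hf ih =>
    obtain ⟨N, hN⟩ := ih
    refine ⟨insert (nodeType a (fun j => (f u).rootTypes j) (k + 1)) N, fun s hs => ?_⟩
    have h : (f s).rootTypes k = (f u).rootTypes k := hs.context hf
    rw [nodeTypes_node, hN s hs, union_insert]
    exact congrArg (fun T => insert ((a, T) : A × Set (DefType A k)) _) h

end Forest

/-! ### Stability of ≡_{k+1} under contexts and exchange -/

namespace LTEquiv

variable {A : Type u} {k : ℕ} {s t : Forest A}

theorem context {f : Forest A → Forest A} (hf : IsContext f) (h : LTEquiv (k + 1) s t) :
    LTEquiv (k + 1) (f s) (f t) := by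
  refine ⟨h.1.context hf, ?_⟩
  obtain ⟨N, hN⟩ := Forest.exists_nodeTypes_context hf k t
  rw [hN s h.1, hN t rfl, h.2]

/-- Since s ∼_k t, the nodes of f and of g keep their (k+1)-types under the exchange, and the types
inside s and t merely move from one summand to the other. -/
theorem swap {f g : Forest A → Forest A} (hf : IsContext f) (hg : IsContext g)
    (h : DefEquiv k s t) : LTEquiv (k + 1) (f s + g t) (f t + g s) := by
  refine ⟨(h.context hf).add (Eq.symm (h.context hg)), ?_⟩
  obtain ⟨N, hN⟩ := Forest.exists_nodeTypes_context hf k t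
  obtain ⟨M, hM⟩ := Forest.exists_nodeTypes_context hg k t
  rw [Forest.nodeTypes_add, Forest.nodeTypes_add, hN s h, hN t rfl, hM s h, hM t rfl,
    union_union_union_comm, union_comm (s.nodeTypes (k + 1)), ← union_union_union_comm]

theorem add_self (k : ℕ) (s : Forest A) : LTEquiv k (s + s) s :=
  ⟨(Forest.rootTypes_add _ _ _).trans (union_self _),
    (Forest.nodeTypes_add _ _ _).trans (union_self _)⟩

end LTEquiv

theorem finite_defType {A : Type u} [Finite A] : ∀ k, Finite (DefType A k)
  | 0 => inferInstanceAs (Finite PUnit)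
  | k + 1 =>
    have := finite_defType (A := A) k
    inferInstanceAs (Finite (A × Set (DefType A k)))

/-- A homomorphism from `H_A` to an idempotent monoid whose kernel is preserved by all contexts. -/
structure IsIdempotentMorphism {A : Type u} {Q : Type v} [AddCommMonoid Q]
    (π : Forest A →+ Q) : Prop where
  context : ∀ {f : Forest A → Forest A}, IsContext f → ∀ {s t}, π s = π t → π (f s) = π (f t)
  add_self : ∀ s, π s + π s = π s

/-- Two forests whose roots have the same `k`-definite types may be exchanged. -/
structure SwapInvariant {A : Type u} {Q : Type v} [AddCommMonoid Q] (k : ℕ)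
    (π : Forest A →+ Q) : Prop where
  swap : ∀ {f g : Forest A → Forest A}, IsContext f → IsContext g →
    ∀ {s t}, DefEquiv k s t → π (f s) + π (g t) = π (f t) + π (g s)

/-! ### Stabilisation of the value pairs -/

section Pairs

variable {A : Type u} {Q : Type v} [AddCommMonoid Q] {π : Forest A →+ Q}

/-- The pairs of values of forests whose roots have the same `m`-definite types. -/
def defPairs (π : Forest A →+ Q) (m : ℕ) : Set (Q × Q) :=
  {z | ∃ s t, DefEquiv m s t ∧ π s = z.1 ∧ π t = z.2}

theorem defPairs_antitone (π : Forest A →+ Q) : Antitone (defPairs π) := by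
  rintro m k hm z ⟨s, t, h, hs, ht⟩
  exact ⟨s, t, h.mono hm, hs, ht⟩

/-- Each root tree of s is matched with a root tree of t with the same label and ∼_m-equivalent
children; the children are replaced by ∼_{m'}-equivalent forests of the same values. The matched
trees need not exhaust t, so their sum t' is only absorbed by t. -/
theorem IsIdempotentMorphism.exists_defEquiv_of_subset (hπ : IsIdempotentMorphism π) {m m' : ℕ}
    (hm : defPairs π m ⊆ defPairs π m') (s t : Forest A)
    (hst : s.rootTypes (m + 1) ⊆ t.rootTypes (m + 1)) :
    ∃ s' t', DefEquiv (m' + 1) s' t' ∧ π s' = π s ∧ π t' + π t = π t := by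
  induction s using Forest.induct with
  | zero => exact ⟨0, 0, rfl, rfl, by rw [map_zero, zero_add]⟩
  | add s₁ s₂ h₁ h₂ =>
    rw [Forest.rootTypes_add, union_subset_iff] at hst
    obtain ⟨x₁, y₁, e₁, p₁, q₁⟩ := h₁ hst.1
    obtain ⟨x₂, y₂, e₂, p₂, q₂⟩ := h₂ hst.2
    exact ⟨x₁ + x₂, y₁ + y₂, e₁.add e₂, by rw [map_add, map_add, p₁, p₂],
      by rw [map_add, add_assoc, q₂, q₁]⟩
  | node v a _ =>
    rw [Forest.rootTypes_node, singleton_subset_iff] at hst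
    obtain ⟨v', b, r, rfl, h⟩ := Forest.exists_eq_node_add hst
    obtain ⟨rfl, hv⟩ := Prod.mk.inj h
    obtain ⟨x, y, e, hx, hy⟩ := hm (show (π v, π v') ∈ _ from ⟨v, v', hv, rfl, rfl⟩)
    refine ⟨x.node a, y.node a, e.node_succ a, hπ.context (.node a .hole) hx, ?_⟩
    rw [hπ.context (.node a .hole) hy, map_add, ← add_assoc, hπ.add_self]

theorem IsIdempotentMorphism.defPairs_succ_subset (hπ : IsIdempotentMorphism π) {m m' : ℕ}
    (hm : defPairs π m ⊆ defPairs π m') : defPairs π (m + 1) ⊆ defPairs π (m' + 1) := by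
  rintro ⟨_, _⟩ ⟨s, t, h, rfl, rfl⟩
  obtain ⟨x₁, y₁, e₁, p₁, q₁⟩ := hπ.exists_defEquiv_of_subset hm s t h.subset
  obtain ⟨x₂, y₂, e₂, p₂, q₂⟩ := hπ.exists_defEquiv_of_subset hm t s h.superset
  -- Both inclusions of root types are combined: y₂ is absorbed by s and y₁ by t.
  refine ⟨x₁ + y₂, y₁ + x₂, e₁.add (Eq.symm e₂), ?_, ?_⟩
  · rw [map_add, p₁, add_comm, q₂]
  · rw [map_add, p₂, q₁]

theorem IsIdempotentMorphism.defPairs_subset (hπ : IsIdempotentMorphism π) [Finite Q] (m : ℕ) :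
    defPairs π (Nat.card Q ^ 2) ⊆ defPairs π m := by
  have hstable : ∃ k ≤ Nat.card Q ^ 2, defPairs π k ⊆ defPairs π (k + 1) := by
    by_contra! hne
    -- Each strict step loses a pair; the bound is absurd at its last index.
    have hcard : ∀ k ≤ Nat.card Q ^ 2 + 1, (defPairs π k).ncard + k ≤ Nat.card Q ^ 2 := by
      intro k
      induction k with
      | zero =>
        intro _
        refine (ncard_le_card _).trans_eq ?_
        rw [Nat.card_prod, sq]
      | succ k ih =>
        intro hk
        have h₁ := ih (by omega)
        have h₂ : (defPairs π (k + 1)).ncard < (defPairs π k).ncard :=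
          ncard_lt_ncard ⟨defPairs_antitone π k.le_succ, hne k (by omega)⟩ (toFinite _)
        omega
    have := hcard _ le_rfl
    omega
  obtain ⟨k, hk, h⟩ := hstable
  have step : ∀ j, defPairs π (k + j) ⊆ defPairs π (k + j + 1) := by
    intro j
    induction j with
    | zero => exact h
    | succ j ih => exact hπ.defPairs_succ_subset ih
  have all : ∀ j, defPairs π k ⊆ defPairs π (k + j) := by
    intro j
    induction j with
    | zero => exact Subset.rfl
    | succ j ih => exact ih.trans (step j)
  exact (defPairs_antitone π hk).trans ((all m).trans (defPairs_antitone π (Nat.le_add_left m k)))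

theorem IsIdempotentMorphism.swapInvariant_card_sq (hπ : IsIdempotentMorphism π) [Finite Q] {m : ℕ}
    (hs : SwapInvariant m π) : SwapInvariant (Nat.card Q ^ 2) π := by
  refine ⟨fun {f g} hf hg {s t} h => ?_⟩
  obtain ⟨x, y, e, hx, hy⟩ := hπ.defPairs_subset m (show (π s, π t) ∈ _ from ⟨s, t, h, rfl, rfl⟩)
  rw [← hπ.context hf hx, ← hπ.context hg hy, ← hπ.context hf hy, ← hπ.context hg hx]
  exact hs.swap hf hg e

end Pairs

/-! ### From exchange at level k to invariance under ≡_{k+1} -/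

namespace SwapInvariant

variable {A : Type u} {Q : Type v} [AddCommMonoid Q] {π : Forest A →+ Q} {k : ℕ}
  {f : Forest A → Forest A}

/-- Exchange one copy of v with one copy of t in f(v + v) + f(t + t). -/
theorem map_context_add (hs : SwapInvariant k π) (hπ : IsIdempotentMorphism π) (hf : IsContext f)
    {v t : Forest A} (h : DefEquiv k v t) : π (f (v + t)) = π (f v) + π (f t) := by
  have h₁ := hs.swap ((IsContext.hole.add v).comp hf) ((IsContext.hole.add t).comp hf) h
  have dup : ∀ r : Forest A, π (f (r + r)) = π (f r) := fun r =>
    hπ.context hf (by rw [map_add, hπ.add_self])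
  rw [dup, dup, add_comm t v, hπ.add_self] at h₁
  exact h₁.symm

theorem map_context_add_self (hs : SwapInvariant k π) (hπ : IsIdempotentMorphism π)
    (hf : IsContext f) {s : Forest A} (h : DefEquiv k s (f s)) : π (f s) + π s = π (f s) := by
  have h₁ : π (f s) + π (f s) = π (f (f s)) + π s := hs.swap hf .hole h
  rw [hπ.add_self] at h₁
  rw [h₁, add_assoc, hπ.add_self]

/-- Exchange gives f s = f(f s) + s in value. As f(f s) absorbs f s, it also absorbs s, and the
right side is f(f s). -/
theorem map_context_context (hs : SwapInvariant k π) (hπ : IsIdempotentMorphism π)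
    (hf : IsContext f) {s : Forest A} (h : DefEquiv k s (f s)) : π (f (f s)) = π (f s) := by
  have h₁ : π (f s) + π (f s) = π (f (f s)) + π s := hs.swap hf .hole h
  rw [hπ.add_self] at h₁
  have h₂ := hs.map_context_add_self hπ hf (h.context hf)
  rw [← h₂]
  conv_lhs => rw [h₁]
  rw [← add_assoc, hπ.add_self, ← h₁]

/-- A tree occurring in `f u` may be added beside `u` if its root has the `k`-definite type of a
root of `u`. -/
theorem exists_map_context_add_node (hs : SwapInvariant k π) (hπ : IsIdempotentMorphism π)
    (hf : IsContext f) (u : Forest A) {a : A} {T : Set (DefType A k)}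
    (hx : ((a, T) : DefType A (k + 1)) ∈ (f u).nodeTypes (k + 1))
    (hu : DefType.trunc k (a, T) ∈ u.rootTypes k) :
    ∃ v : Forest A, v.rootTypes k = T ∧
      ∀ t, DefEquiv k t (v.node a) → π (f (u + v.node a + t)) = π (f (u + t)) := by
  obtain ⟨u', b, r, rfl, hb⟩ := Forest.exists_eq_node_add hu
  have huv : ∀ v : Forest A, v.rootTypes k = T → DefEquiv k (u'.node b) (v.node a) := by
    rintro v rfl
    unfold DefEquiv
    rw [Forest.rootTypes_node, Forest.rootTypes_node, ← hb]
    exact congrArg _ (Forest.trunc_nodeType k v a)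
  generalize u'.node b = u₁ at *
  have hT : ∀ (s : Forest A) {x : DefType A (k + 1)}, x ∈ s.nodeTypes (k + 1) → x = (a, T) →
      ∃ (v : Forest A) (g : Forest A → Forest A), IsContext g ∧ s = g (v.node a) ∧ v.rootTypes k = T := by
    rintro s x hx rfl
    obtain ⟨v, c, g, hg, hs', h⟩ := Forest.exists_eq_context_node hx
    obtain ⟨rfl, hv⟩ := Prod.mk.inj h
    exact ⟨v, g, hg, hs', hv.symm⟩
  induction hf with
  | hole =>
    obtain ⟨v, g, hg, h, hv⟩ := hT _ hx rfl
    refine ⟨v, hv, fun t _ => ?_⟩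
    -- Exchanging u₁ with the occurrence of the tree inside u brings the tree up to the roots.
    have h₁ : π (g (v.node a)) + π u₁ = π (g u₁) + π (v.node a) :=
      hs.swap hg .hole (Eq.symm (huv v hv))
    have h₂ : π (u₁ + r) = π (g u₁) + π (v.node a) := by
      rw [← h₁, ← h, map_add, add_right_comm, hπ.add_self]
    rw [map_add, map_add, map_add _ _ t, h₂, add_assoc (π (g u₁)), hπ.add_self]
  | @add f r' hf ih =>
    rw [Forest.nodeTypes_add] at hx
    rcases hx with hx | hx
    · obtain ⟨v, hv, h⟩ := ih hx
      exact ⟨v, hv, fun t ht => by rw [map_add, map_add, h t ht]⟩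
    · obtain ⟨v, g, hg, rfl, hv⟩ := hT _ hx rfl
      refine ⟨v, hv, fun t _ => ?_⟩
      -- The tree lies in the forest beside f. A spare copy of u₁ is exchanged with it, with and
      -- without the extra tree; idempotence identifies the two results.
      have h₁ := hs.swap ((IsContext.hole.add (u₁ + r + v.node a + t)).comp hf) hg (huv v hv)
      have h₂ := hs.swap ((IsContext.hole.add (u₁ + r + t)).comp hf) hg (huv v hv)
      have e₁ : π (f (u₁ + (u₁ + r + v.node a + t))) = π (f (u₁ + r + v.node a + t)) :=
        hπ.context hf (by simp only [map_add, ← add_assoc, hπ.add_self])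
      have e₂ : π (f (u₁ + (u₁ + r + t))) = π (f (u₁ + r + t)) :=
        hπ.context hf (by simp only [map_add, ← add_assoc, hπ.add_self])
      have e₃ : π (f (v.node a + (u₁ + r + v.node a + t))) = π (f (v.node a + (u₁ + r + t))) :=
        hπ.context hf (by
          rw [add_right_comm (u₁ + r), add_comm _ (v.node a), map_add, map_add, ← add_assoc,
            hπ.add_self, ← map_add])
      rw [e₁, e₃, ← h₂, e₂] at h₁
      rwa [map_add, map_add]
  | @node f c hf ih =>
    rw [Forest.nodeTypes_node] at hx
    rcases hx with hx | hx
    · obtain ⟨rfl, h⟩ := Prod.mk.inj hx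
      -- The tree is p(u₁), for the context p of `hp`, and u₁ ∼_k p(u₁). In value, p(u₁ + t + p(u₁))
      -- = p(u₁ + t) + p(p(u₁)) by distributivity, and p(p(u₁)) = p(u₁) is already a summand of
      -- p(u₁) + p(t).
      refine ⟨f (u₁ + r), h.symm, fun t ht => ?_⟩
      have hp : IsContext fun s => (f (s + r)).node a := ((IsContext.hole.add r).comp hf).node a
      have hw := huv _ h.symm
      have hut : DefEquiv k u₁ t := hw.trans (Eq.symm ht)
      have h₁ := hs.map_context_add hπ hp hut
      have h₂ := hs.map_context_add hπ hp (v := u₁ + t) (t := (f (u₁ + r)).node a) (by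
        unfold DefEquiv at *
        rw [Forest.rootTypes_add, ← hut, union_self, hw])
      have h₃ := hs.map_context_context hπ hp hw
      rw [h₃, h₁, add_right_comm (π _), hπ.add_self, ← h₁] at h₂
      rw [add_right_comm u₁ r t, ← h₂]
      exact congrArg (fun s => π ((f s).node a)) (by abel)
    · obtain ⟨v, hv, h⟩ := ih hx
      exact ⟨v, hv, fun t ht => hπ.context (.node c .hole) (h t ht)⟩

/-- A forest whose nodes and roots all have definite types occurring in `f u` and among the roots
of `u` may be added beside `u`. -/
theorem map_context_add_of_subset (hs : SwapInvariant k π) (hπ : IsIdempotentMorphism π)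
    (t : Forest A) (hf : IsContext f) (u : Forest A)
    (hN : t.nodeTypes (k + 1) ⊆ (f u).nodeTypes (k + 1))
    (hR : t.rootTypes k ⊆ u.rootTypes k) : π (f (u + t)) = π (f u) := by
  have hmono : ∀ {f : Forest A → Forest A}, IsContext f → ∀ u t : Forest A,
      t.rootTypes k ⊆ u.rootTypes k →
      (f u).nodeTypes (k + 1) ⊆ (f (u + t)).nodeTypes (k + 1) := by
    intro f hf u t h
    obtain ⟨N, hN⟩ := Forest.exists_nodeTypes_context hf k u
    rw [hN u rfl, hN (u + t) ((Forest.rootTypes_add _ _ _).trans (union_eq_left.2 h)),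
      Forest.nodeTypes_add]
    exact union_subset_union_left _ subset_union_left
  induction t using Forest.induct generalizing f u with
  | zero => rw [add_zero]
  | add t₁ t₂ h₁ h₂ =>
    rw [Forest.nodeTypes_add, union_subset_iff] at hN
    rw [Forest.rootTypes_add, union_subset_iff] at hR
    rw [← add_assoc, h₂ hf (u + t₁) (hN.2.trans (hmono hf u t₁ hR.1)), h₁ hf u hN.1 hR.1]
    rw [Forest.rootTypes_add]
    exact hR.2.trans subset_union_left
  | node t a ih =>
    rw [Forest.nodeTypes_node, insert_subset_iff] at hN
    rw [Forest.rootTypes_node, singleton_subset_iff] at hR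
    -- The forest v has the root types of t, so beside u the trees of v and t merge into one tree
    -- over v + t. The induction hypothesis, in the larger context `hg`, removes t from it; the tree
    -- over v is then removed by `e₁`.
    obtain ⟨v, hv, h⟩ := hs.exists_map_context_add_node hπ hf u hN.1
      (by rw [← Forest.trunc_nodeType] at hR; exact hR)
    have hw : DefEquiv k (t.node a) (v.node a) :=
      (DefEquiv.node_succ (Eq.symm hv) a).of_succ
    have hvu : (v.node a).rootTypes k ⊆ u.rootTypes k := by
      rw [← hw, Forest.rootTypes_node]
      exact singleton_subset_iff.2 hR
    -- A root tree of u can be duplicated for free; the copy serves as the forest of the same type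
    -- that `h` requires.
    obtain ⟨u', b, r, hu', hb⟩ := Forest.exists_eq_node_add hR
    have hb' : DefEquiv k (u'.node b) (v.node a) := by
      refine Eq.trans ?_ hw
      rw [Forest.rootTypes_node, Forest.rootTypes_node, hb]
    have huu : π (u + u'.node b) = π u := by
      rw [hu', add_right_comm, map_add, map_add _ _ (u'.node b), hπ.add_self, ← map_add]
    have hg : IsContext fun s : Forest A => f (s.node a + u) :=
      ((IsContext.hole.node a).add u).comp hf
    have e₁ : π (f (v.node a + u)) = π (f u) := by
      rw [← hπ.context hf huu, ← h _ hb']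
      refine hπ.context hf ?_
      rw [add_right_comm, map_add _ (u + _), huu, ← map_add, add_comm]
    have e₂ := ih hg v (hN.2.trans (by
      have := hmono hf u (v.node a) hvu
      rwa [add_comm u] at this)) (Eq.subset (Eq.symm hv))
    have e₃ : π (f ((v + t).node a + u)) = π (f (u + v.node a + t.node a)) := by
      refine hπ.context hf ?_
      rw [map_add, hs.map_context_add hπ (IsContext.hole.node a) hv, ← map_add, ← map_add,
        add_comm _ u, add_assoc]
    rw [← h _ hw, ← e₃, e₂, e₁]

theorem eq_of_ltEquiv (hs : SwapInvariant k π) (hπ : IsIdempotentMorphism π) {s t : Forest A}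
    (h : LTEquiv (k + 1) s t) : π s = π t := by
  have h₁ := hs.map_context_add_of_subset hπ t .hole s h.2.superset (Eq.superset h.1)
  have h₂ := hs.map_context_add_of_subset hπ s .hole t h.2.subset (Eq.subset h.1)
  rw [← h₁, ← h₂, add_comm]

end SwapInvariant

/-! ### The syntactic morphism of a locally testable language -/

section Syntactic

variable {A : Type u} {L : Set (Forest A)} {k : ℕ}

theorem mk'_synConH_eq_iff {s t : Forest A} :
    (synConH L).mk' s = (synConH L).mk' t ↔ ∀ p : Context A, p.1 s ∈ L ↔ p.1 t ∈ L :=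
  (synConH L).eq

theorem IsKLocallyTestable.mk'_synConH_eq (hL : IsKLocallyTestable (k + 1) L) {s t : Forest A}
    (h : LTEquiv (k + 1) s t) : (synConH L).mk' s = (synConH L).mk' t :=
  mk'_synConH_eq_iff.2 fun p =>
    ⟨hL.2 _ _ (h.context p.2), hL.2 _ _ (LTEquiv.context p.2 ⟨Eq.symm h.1, h.2.symm⟩)⟩

theorem IsKLocallyTestable.isIdempotentMorphism (hL : IsKLocallyTestable (k + 1) L) :
    IsIdempotentMorphism (synConH L).mk' where
  context hf _ _ h := mk'_synConH_eq_iff.2 fun p => mk'_synConH_eq_iff.1 h ⟨_, hf.comp p.2⟩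
  add_self s := by rw [← map_add]; exact hL.mk'_synConH_eq (LTEquiv.add_self _ s)

theorem IsKLocallyTestable.swapInvariant (hL : IsKLocallyTestable (k + 1) L) :
    SwapInvariant k (synConH L).mk' := by
  refine ⟨fun {f g} hf hg {s t} h => ?_⟩
  rw [← map_add, ← map_add]
  exact hL.mk'_synConH_eq (LTEquiv.swap hf hg h)

/-- A syntactic class is determined by the two type sets of any representative, and a finite
alphabet has finitely many definite types of each level. -/
theorem IsKLocallyTestable.finite_quotient [Finite A] (hL : IsKLocallyTestable (k + 1) L) :
    Finite (synConH L).Quotient := by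
  have := finite_defType (A := A) k
  have := finite_defType (A := A) (k + 1)
  let F : (synConH L).Quotient → Set (DefType A k) × Set (DefType A (k + 1)) := fun x =>
    (Forest.rootTypes k (Quotient.out x), Forest.nodeTypes (k + 1) (Quotient.out x))
  refine Finite.of_injective F fun x y h => ?_
  obtain ⟨h₁, h₂⟩ := Prod.mk.inj h
  have h₃ : (synConH L).mk' (Quotient.out x) = (synConH L).mk' (Quotient.out y) :=
    hL.mk'_synConH_eq ⟨h₁, h₂⟩
  have hout : ∀ z : (synConH L).Quotient, (synConH L).mk' (Quotient.out z) = z := Quotient.out_eq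
  rwa [hout, hout] at h₃

end Syntactic

end ForestLang

/-- If a forest language `L` over a finite alphabet is locally testable, then the horizontal monoid
`H_L` of its syntactic forest algebra is finite, and `L` is `(|H_L|^2 + 1)`-locally testable. -/
theorem mainTheorem3 {A : Type u} [Finite A] (L : Set (ForestLang.Forest A))
    (hL : ForestLang.IsLocallyTestable L) :
    Finite (ForestLang.syntacticForestAlgebra L).H ∧
      ForestLang.IsKLocallyTestable (Nat.card (ForestLang.syntacticForestAlgebra L).H ^ 2 + 1) L := by
  obtain ⟨_ | k, hk⟩ := hL
  · exact absurd hk.1 (lt_irrefl 0)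
  have hfin := hk.finite_quotient
  have hπ := hk.isIdempotentMorphism
  refine ⟨hfin, Nat.succ_pos _, fun s t h hs => ?_⟩
  have hst := (hπ.swapInvariant_card_sq hk.swapInvariant).eq_of_ltEquiv hπ h
  -- The empty context turns syntactic equality into membership in `L`.
  exact (ForestLang.mk'_synConH_eq_iff.1 hst 1).1 hs
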